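/- For a finite simple graph $G=(V,E)$ and $v\in V$ let $N[v]$ be the set consisting of $v$ and all vertices adjacent to $v$. A conflict-free $k$-coloring of $G$ is an assignment of colors from $\{1,\dots,k\}$ to the vertices of some subset of $V$ such that every $v\in V$ has a colored vertex $u\in N[v]$ whose color occurs only once in $N[v]$. The conflict-free chromatic number $\chi_{CF}(G)$ is the least $k$ for which $G$ has a conflict-free $k$-coloring. A disk graph is an intersection graph of closed disks of arbitrary positive radii in the Euclidean plane; a square graph is an intersection graph of closed axis-aligned squares of arbitrary positive side lengths in the plane. **Theorem.** The conflict-free chromatic number of disk graphs and of square graphs on $n$ vertices can be $\Omega(\sqrt{\log n})$. Precisely, for each of the two classes $\mathcal G$ (disk graphs; square graphs): 1. there is a constant $c>0$ such that for every $n\ge 1$ there is a graph $G\in\mathcal G$ with exactly $n$ vertices and $\chi_{CF}(G)\ge c\sqrt{\log n}$; 2. there is a constant $C>0$ such that for every $k\ge 1$ there is a graph $D_k\in\mathcal G$ with $\chi_{CF}(D_k)=k$ and at most $C\cdot 2^{2k^2}$ vertices. -/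

import Mathlib

/-- The closed neighborhood `N[v]` of `v`: the vertex `v` and all vertices adjacent to it. -/
def SimpleGraph.closedNbhd {V : Type*} (G : SimpleGraph V) (v : V) : Set V :=
  insert v (G.neighborSet v)

/-- A coloring of a subset of the vertices with colors from `κ` (the value `none` means that the
vertex is left uncolored) is conflict-free if every vertex `v` has a conflict-free neighbor:
a colored vertex `u ∈ N[v]` whose color occurs only once in `N[v]`. -/
def SimpleGraph.IsConflictFree {V κ : Type*} (G : SimpleGraph V) (χ : V → Option κ) : Prop :=
  ∀ v : V, ∃ u ∈ G.closedNbhd v, ∃ a : κ, χ u = some a ∧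
    ∀ w ∈ G.closedNbhd v, χ w = some a → w = u

/-- `G` has a conflict-free coloring with (at most) `k` colors. -/
def SimpleGraph.ConflictFreeColorable {V : Type*} (G : SimpleGraph V) (k : ℕ) : Prop :=
  ∃ χ : V → Option (Fin k), G.IsConflictFree χ

/-- Giving all vertices different colors is conflict-free, so the minimum below is over a nonempty
set. -/
theorem SimpleGraph.conflictFreeColorable_card {V : Type*} [Finite V] (G : SimpleGraph V) :
    G.ConflictFreeColorable (Nat.card V) := by
  refine ⟨fun v => some (Finite.equivFin V v), fun v => ⟨v, Or.inl rfl, _, rfl, ?_⟩⟩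
  intro w _ hw
  exact (Finite.equivFin V).injective (Option.some.inj hw)

/-- The conflict-free chromatic number of a finite graph. -/
noncomputable def SimpleGraph.conflictFreeNumber {V : Type*} [Finite V] (G : SimpleGraph V) : ℕ :=
  sInf {k : ℕ | G.ConflictFreeColorable k}

/-- `G` is the intersection graph of the family of sets `S`, indexed by its vertices. -/
def SimpleGraph.IsIntersectionGraph {V X : Type*} (G : SimpleGraph V) (S : V → Set X) : Prop :=
  ∀ u v : V, G.Adj u v ↔ u ≠ v ∧ (S u ∩ S v).Nonempty

/-- The (closed) axis-aligned square in the plane with center `p` and side length `s`. -/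
def axisSquare (p : EuclideanSpace ℝ (Fin 2)) (s : ℝ) : Set (EuclideanSpace ℝ (Fin 2)) :=
  {q | ∀ i, |q i - p i| ≤ s / 2}

/-- Disk graphs: intersection graphs of (closed) disks of arbitrary positive radii in the
Euclidean plane. -/
def SimpleGraph.IsDiskGraph {V : Type*} (G : SimpleGraph V) : Prop :=
  ∃ (p : V → EuclideanSpace ℝ (Fin 2)) (r : V → ℝ), (∀ v, 0 < r v) ∧
    G.IsIntersectionGraph fun v => Metric.closedBall (p v) (r v)

/-- Square graphs: intersection graphs of axis-aligned squares of arbitrary positive side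
lengths in the plane. -/
def SimpleGraph.IsSquareGraph {V : Type*} (G : SimpleGraph V) : Prop :=
  ∃ (p : V → EuclideanSpace ℝ (Fin 2)) (s : V → ℝ), (∀ v, 0 < s v) ∧
    G.IsIntersectionGraph fun v => axisSquare (p v) (s v)

open Filter Topology

namespace SimpleGraph

/-! ### Conflict-free colorings -/

/-! Disks and squares are the balls of the Euclidean and the maximum norm, so both cases follow from
one construction of graphs `G` that are not conflict-free `m`-colorable, by induction on `m`. Take
`2 ^ (m + 1)` congruent balls whose intervals all occur as cells of the arrangement, and put two
tiny copies of `G` into the cell of each interval. Adjacency among the large balls plays no role.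
Suppose `m + 1` colors suffice. If no color is unique in an interval, its copies must serve
themselves; as `m` colors are too few for `G`, each copy uses every color and the interval uses none
(`IsAttachment.color_of_no_unique`). An uncolored large ball would then see every color twice, so
all of them are colored. But `2 ^ (m + 1)` vertices in `m + 1` colors contain an interval without a
unique color (`exists_interval_no_unique_color`), a contradiction. Each step multiplies the size by
at most `2 ^ (2 * m + 4)`. Adding isolated vertices or deleting vertices then adjusts the order or
the conflict-free number exactly. -/

theorem mem_closedNbhd {V : Type*} {G : SimpleGraph V} {u v : V} :
    u ∈ G.closedNbhd v ↔ u = v ∨ G.Adj v u := Iff.rfl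

theorem conflictFreeColorable_of_card_le {V κ : Type*} [Fintype κ] {G : SimpleGraph V}
    {χ : V → Option κ} (h : G.IsConflictFree χ) {k : ℕ} (hk : Fintype.card κ ≤ k) :
    G.ConflictFreeColorable k := by
  obtain ⟨e⟩ : Nonempty (κ ↪ Fin k) := Function.Embedding.nonempty_of_card_le (by simpa using hk)
  refine ⟨fun v => (χ v).map e, fun v => ?_⟩
  obtain ⟨u, hu, a, ha, hw⟩ := h v
  refine ⟨u, hu, e a, by simp [ha], fun w hwv hwa => hw w hwv ?_⟩
  simpa [Option.map_eq_some_iff] using hwa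

theorem ConflictFreeColorable.mono {V : Type*} {G : SimpleGraph V} {k l : ℕ}
    (h : G.ConflictFreeColorable k) (hkl : k ≤ l) : G.ConflictFreeColorable l := by
  obtain ⟨χ, hχ⟩ := h
  exact conflictFreeColorable_of_card_le hχ (by simpa using hkl)

theorem conflictFreeNumber_le_iff {V : Type*} [Finite V] {G : SimpleGraph V} {k : ℕ} :
    G.conflictFreeNumber ≤ k ↔ G.ConflictFreeColorable k := by
  constructor
  · have : G.ConflictFreeColorable G.conflictFreeNumber :=
      Nat.sInf_mem (s := {k : ℕ | G.ConflictFreeColorable k}) ⟨_, G.conflictFreeColorable_card⟩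
    exact this.mono
  · exact fun h => Nat.sInf_le h

theorem ConflictFreeColorable.of_comap_equiv {V W : Type*} {G : SimpleGraph V} (e : W ≃ V) {k : ℕ}
    (h : (G.comap e).ConflictFreeColorable k) : G.ConflictFreeColorable k := by
  obtain ⟨χ, hχ⟩ := h
  refine ⟨fun v => χ (e.symm v), fun v => ?_⟩
  obtain ⟨u, hu, a, ha, hw⟩ := hχ (e.symm v)
  refine ⟨e u, by simpa [mem_closedNbhd, Equiv.eq_symm_apply] using hu, a, by simpa using ha,
    fun w hwv hwa => ?_⟩
  rw [← hw (e.symm w) (by simpa [mem_closedNbhd] using hwv) hwa, e.apply_symm_apply]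

/-- Deleting a vertex lowers the conflict-free chromatic number by at most one. -/
theorem ConflictFreeColorable.of_comap_castSucc {n k : ℕ} {G : SimpleGraph (Fin (n + 1))}
    (h : (G.comap Fin.castSucc).ConflictFreeColorable k) : G.ConflictFreeColorable (k + 1) := by
  obtain ⟨χ, hχ⟩ := h
  -- The restored vertex gets a color of its own: it serves itself and spoils no other color.
  refine ⟨Fin.lastCases (some (Fin.last k)) fun i => (χ i).map Fin.castSucc, fun v => ?_⟩
  induction v using Fin.lastCases with
  | last =>
    refine ⟨Fin.last n, Or.inl rfl, Fin.last k, by simp, fun w _ hw => ?_⟩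
    induction w using Fin.lastCases with
    | last => rfl
    | cast i =>
      simp only [Fin.lastCases_castSucc, Option.map_eq_some_iff] at hw
      obtain ⟨a, -, ha⟩ := hw
      exact absurd ha (Fin.castSucc_lt_last a).ne
  | cast v =>
    obtain ⟨u, hu, a, ha, hw⟩ := hχ v
    refine ⟨u.castSucc, by simpa [mem_closedNbhd] using hu, a.castSucc, by simp [ha],
      fun w hwv hwa => ?_⟩
    induction w using Fin.lastCases with
    | last =>
      simp only [Fin.lastCases_last, Option.some.injEq] at hwa
      exact absurd hwa (Fin.castSucc_lt_last a).ne'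
    | cast w =>
      rw [hw w (by simpa [mem_closedNbhd] using hwv)]
      simpa [Option.map_eq_some_iff] using hwa

/-- Every value up to the conflict-free chromatic number is attained by deleting vertices. -/
theorem exists_conflictFreeNumber_eq {P : ∀ n, SimpleGraph (Fin n) → Prop}
    (hP : ∀ n (G : SimpleGraph (Fin (n + 1))), P (n + 1) G → P n (G.comap Fin.castSucc))
    {k n : ℕ} (G : SimpleGraph (Fin n)) (hG : P n G) (hk : k ≤ G.conflictFreeNumber) :
    ∃ m ≤ n, ∃ H : SimpleGraph (Fin m), P m H ∧ H.conflictFreeNumber = k := by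
  induction n with
  | zero =>
    have h : G.conflictFreeNumber ≤ 0 :=
      conflictFreeNumber_le_iff.2 ⟨fun _ => none, fun v => v.elim0⟩
    exact ⟨0, le_rfl, G, hG, by omega⟩
  | succ n ih =>
    rcases hk.eq_or_lt with h | h
    · exact ⟨n + 1, le_rfl, G, hG, h.symm⟩
    · have h' : G.conflictFreeNumber ≤ (G.comap Fin.castSucc).conflictFreeNumber + 1 :=
        conflictFreeNumber_le_iff.2 (conflictFreeNumber_le_iff.1 le_rfl).of_comap_castSucc
      obtain ⟨m, hm, H, hH⟩ := ih _ (hP n G hG) (by omega)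
      exact ⟨m, by omega, H, hH⟩

/-- Adding an isolated vertex does not make a conflict-free coloring easier. -/
theorem ConflictFreeColorable.comap_castSucc_of_isolated {n k : ℕ} {G : SimpleGraph (Fin (n + 1))}
    (h : G.ConflictFreeColorable k) (hG : ∀ i, ¬ G.Adj i (Fin.last n)) :
    (G.comap Fin.castSucc).ConflictFreeColorable k := by
  obtain ⟨χ, hχ⟩ := h
  refine ⟨fun i => χ i.castSucc, fun v => ?_⟩
  obtain ⟨u, hu, a, ha, hw⟩ := hχ v.castSucc
  induction u using Fin.lastCases with
  | last =>
    rcases hu with h | h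
    · exact absurd h (Fin.castSucc_lt_last v).ne'
    · exact absurd h (hG _)
  | cast u =>
    refine ⟨u, by simpa [mem_closedNbhd] using hu, a, ha, fun w hwv hwa => ?_⟩
    exact Fin.castSucc_injective _ (hw w.castSucc (by simpa [mem_closedNbhd] using hwv) hwa)

/-! ### Unique colors in intervals -/

/-- A sequence of length `2 ^ m` in at most `m` colors has an interval without a unique color. -/
theorem _root_.exists_interval_no_unique_color {κ : Type*} [DecidableEq κ] (f : ℕ → κ) (m x : ℕ)
    (s : Finset κ) (hs : s.card ≤ m) (hf : ∀ j, x ≤ j → j < x + 2 ^ m → f j ∈ s) :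
    ∃ a b, x ≤ a ∧ a ≤ b ∧ b < x + 2 ^ m ∧
      ∀ i, a ≤ i → i ≤ b → ∃ j, a ≤ j ∧ j ≤ b ∧ j ≠ i ∧ f j = f i := by
  induction m generalizing x s with
  | zero =>
    have h := hf x le_rfl (by simp)
    simp_all
  | succ m ih =>
    by_contra! hcon
    have hpos : 0 < 2 ^ m := by positivity
    have hpow : 2 ^ (m + 1) = 2 * 2 ^ m := by ring
    obtain ⟨i, hxi, hix, hi⟩ := hcon x (x + 2 ^ (m + 1) - 1) le_rfl (by omega) (by omega)
    have hcard : (s.erase (f i)).card ≤ m := by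
      rw [Finset.card_erase_of_mem (hf i hxi (by omega))]; omega
    -- One half of the interval misses the position `i` of the unique color, hence uses one color
    -- fewer.
    obtain ⟨y, hxy, hyx, hiy⟩ : ∃ y, x ≤ y ∧ y + 2 ^ m ≤ x + 2 ^ (m + 1) ∧
        (i < y ∨ y + 2 ^ m ≤ i) := by
      by_cases h : x + 2 ^ m ≤ i
      · exact ⟨x, by omega, by omega, by omega⟩
      · exact ⟨x + 2 ^ m, by omega, by omega, by omega⟩
    obtain ⟨a, b, h1, h2, h3, h4⟩ := ih y _ hcard fun j hj hj' =>
      Finset.mem_erase.2 ⟨hi j (by omega) (by omega) (by omega), hf j (by omega) (by omega)⟩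
    obtain ⟨l, hl1, hl2, hl3⟩ := hcon a b (by omega) h2 (by omega)
    obtain ⟨j, hj1, hj2, hj3, hj4⟩ := h4 l hl1 hl2
    exact hl3 j hj1 hj2 hj3 hj4

/-! ### Attaching copies of a graph to sets of vertices -/

/-- `K` consists of the vertices `ι` and of one copy of `G` for each `t : T`, which is joined
exactly to the vertices in `S t`. -/
structure IsAttachment {ι T V : Type*} (G : SimpleGraph V) (S : T → Set ι)
    (K : SimpleGraph (ι ⊕ T × V)) : Prop where
  adj_copy : ∀ t v t' v', K.Adj (.inr (t, v)) (.inr (t', v')) ↔ t = t' ∧ G.Adj v v'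
  adj_base : ∀ i t v, K.Adj (.inl i) (.inr (t, v)) ↔ i ∈ S t

/-- If no color is unique in `S t`, and fewer colors than there are do not suffice for `G`, then
no color occurs in `S t` and every color occurs in the copy of `G` at `t`. -/
theorem IsAttachment.color_of_no_unique {ι T V κ : Type*} [Fintype κ] {G : SimpleGraph V}
    {S : T → Set ι} {K : SimpleGraph (ι ⊕ T × V)} (hK : G.IsAttachment S K) {m : ℕ}
    (hG : ¬ G.ConflictFreeColorable m) (hκ : Fintype.card κ = m + 1)
    {χ : ι ⊕ T × V → Option κ} (hχ : K.IsConflictFree χ) {t : T}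
    (ht : ∀ i ∈ S t, ∀ a, χ (.inl i) = some a → ∃ j ∈ S t, j ≠ i ∧ χ (.inl j) = some a) (c : κ) :
    (∀ i ∈ S t, χ (.inl i) ≠ some c) ∧ ∃ v, χ (.inr (t, v)) = some c := by
  classical
  by_contra hcon
  apply hG
  have key : ∀ v, ∃ u ∈ G.closedNbhd v, ∃ a, a ≠ c ∧ χ (.inr (t, u)) = some a ∧
      ∀ w ∈ G.closedNbhd v, χ (.inr (t, w)) = some a → w = u := by
    intro v
    obtain ⟨u, hu, a, ha, hw⟩ := hχ (.inr (t, v))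
    rcases u with i | ⟨t', u⟩
    -- A base vertex cannot serve `v`, since `N[v]` contains all of `S t`, where its color repeats.
    · have hit : i ∈ S t := by
        rcases hu with h | h
        · simp at h
        · exact (hK.adj_base _ _ _).1 (K.adj_symm h)
      obtain ⟨j, hj, hji, hja⟩ := ht i hit a ha
      exact absurd (Sum.inl_injective
        (hw (.inl j) (Or.inr (K.adj_symm ((hK.adj_base _ _ _).2 hj))) hja)) hji
    · obtain ⟨rfl, huv⟩ : t' = t ∧ u ∈ G.closedNbhd v := by
        rcases hu with h | h
        · simp only [Sum.inr.injEq, Prod.mk.injEq] at h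
          exact ⟨h.1, Or.inl h.2⟩
        · obtain ⟨h1, h2⟩ := (hK.adj_copy _ _ _ _).1 h
          exact ⟨h1.symm, Or.inr h2⟩
      refine ⟨u, huv, a, ?_, ha, fun w hwv hwa => ?_⟩
      -- If `c` served `v`, it would occur in the copy and, being unique in `N[v]`, nowhere in `S
      -- t`: exactly what `hcon` denies.
      · rintro rfl
        refine hcon ⟨fun i hi hia => ?_, u, ha⟩
        have := hw (.inl i) (Or.inr (K.adj_symm ((hK.adj_base _ _ _).2 hi))) hia
        simp at this
      · have := hw (.inr (t', w)) (by
          rcases hwv with h | h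
          · exact Or.inl (by rw [h])
          · exact Or.inr ((hK.adj_copy _ _ _ _).2 ⟨rfl, h⟩)) hwa
        simpa using this
  -- Since `c` serves no vertex of the copy, erasing it leaves a conflict-free coloring with `m`
  -- colors.
  refine conflictFreeColorable_of_card_le (κ := {a : κ // a ≠ c})
    (χ := fun v => (χ (.inr (t, v))).bind fun a => if h : a ≠ c then some ⟨a, h⟩ else none)
    (fun v => ?_) (by simp [Fintype.card_subtype_compl, hκ])
  obtain ⟨u, hu, a, hac, ha, hw⟩ := key v
  refine ⟨u, hu, ⟨a, hac⟩, by simp [ha, hac], fun w hwv hwa => hw w hwv ?_⟩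
  obtain ⟨b, hb, hb'⟩ := Option.bind_eq_some_iff.1 hwa
  split_ifs at hb' with h
  simp only [Option.some.injEq, Subtype.mk.injEq] at hb'
  rw [hb, hb']

/-- The intervals of `Fin l`, each taken twice. -/
abbrev _root_.DoubledInterval (l : ℕ) : Type := {p : Fin l × Fin l // p.1 ≤ p.2} × Bool

/-- The vertices that form the interval. -/
def _root_.DoubledInterval.toSet {l : ℕ} (t : DoubledInterval l) : Set (Fin l) :=
  Set.Icc t.1.1.1 t.1.1.2

/-- Attaching two copies of `G` to each interval of `2 ^ (m + 1)` vertices forces one more color. -/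
theorem IsAttachment.not_conflictFreeColorable {V : Type*} {G : SimpleGraph V} {m : ℕ}
    {K : SimpleGraph (Fin (2 ^ (m + 1)) ⊕ DoubledInterval (2 ^ (m + 1)) × V)}
    (hK : G.IsAttachment DoubledInterval.toSet K) (hG : ¬ G.ConflictFreeColorable m) :
    ¬ K.ConflictFreeColorable (m + 1) := by
  rintro ⟨χ, hχ⟩
  have color := fun t => hK.color_of_no_unique hG (by simp) hχ (t := t)
  have colored : ∀ i, ∃ a, χ (.inl i) = some a := by
    intro i
    by_contra! hi
    -- For an uncolored `i`, the interval `{i}` has no unique color vacuously; the two copies there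
    -- show every color to `i` at least twice.
    let t : Bool → DoubledInterval (2 ^ (m + 1)) := fun β => (⟨(i, i), le_rfl⟩, β)
    have mem : ∀ β, i ∈ (t β).toSet := fun β => ⟨le_rfl, le_rfl⟩
    have occurs : ∀ β c, ∃ v, χ (.inr (t β, v)) = some c := fun β c => by
      refine (color (t β) (fun j hj a ha => ?_) c).2
      have : j = i := le_antisymm hj.2 hj.1
      exact absurd (this ▸ ha) (hi a)
    obtain ⟨u, -, a, -, hw⟩ := hχ (.inl i)
    obtain ⟨v, hv⟩ := occurs false a
    obtain ⟨v', hv'⟩ := occurs true a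
    have h := (hw _ (Or.inr ((hK.adj_base _ _ _).2 (mem false))) hv).trans
      (hw _ (Or.inr ((hK.adj_base _ _ _).2 (mem true))) hv').symm
    simp [t] at h
  choose f hf using colored
  have hpos : 0 < 2 ^ (m + 1) := by positivity
  -- The remainder only makes the sequence total; all indices used are below `2 ^ (m + 1)`.
  obtain ⟨a, b, -, hab, hb, h⟩ := exists_interval_no_unique_color
    (fun n => f ⟨n % 2 ^ (m + 1), Nat.mod_lt _ hpos⟩) (m + 1) 0 Finset.univ (by simp)
    (fun _ _ _ => Finset.mem_univ _)
  rw [zero_add] at hb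
  let t : DoubledInterval (2 ^ (m + 1)) := (⟨(⟨a, by omega⟩, ⟨b, hb⟩), hab⟩, false)
  refine (color t ?_ (f ⟨a, by omega⟩)).1 ⟨a, by omega⟩ ⟨le_rfl, hab⟩ (hf _)
  rintro ⟨i, hi⟩ ⟨hai, hib⟩ c hc
  obtain ⟨j, haj, hjb, hji, hfj⟩ := h i hai hib
  have hj : j < 2 ^ (m + 1) := by omega
  simp only [Nat.mod_eq_of_lt hi, Nat.mod_eq_of_lt hj] at hfj
  exact ⟨⟨j, hj⟩, ⟨haj, hjb⟩, by simpa using hji, by rw [hf, hfj, ← hf, hc]⟩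

/-! ### Intersection graphs of balls in a normed space -/

/-- Intersection graphs of closed balls of positive radii. -/
def IsBallGraph (E : Type*) [NormedAddCommGroup E] {V : Type*} (G : SimpleGraph V) : Prop :=
  ∃ (p : V → E) (r : V → ℝ), (∀ v, 0 < r v) ∧
    ∀ u v, G.Adj u v ↔ u ≠ v ∧ Dist.dist (p u) (p v) ≤ r u + r v

theorem closedBall_inter_closedBall_nonempty_iff {E : Type*} [NormedAddCommGroup E]
    [NormedSpace ℝ E] {x y : E} {r s : ℝ} (hr : 0 ≤ r) (hs : 0 ≤ s) :
    (Metric.closedBall x r ∩ Metric.closedBall y s).Nonempty ↔ Dist.dist x y ≤ r + s := by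
  rw [← Set.not_disjoint_iff_nonempty_inter, disjoint_closedBall_closedBall_iff hr hs, not_lt]

theorem IsBallGraph.isDiskGraph {V : Type*} {G : SimpleGraph V}
    (h : G.IsBallGraph (EuclideanSpace ℝ (Fin 2))) : G.IsDiskGraph := by
  obtain ⟨p, r, hr, h⟩ := h
  refine ⟨p, r, hr, fun u v => ?_⟩
  rw [h, closedBall_inter_closedBall_nonempty_iff (hr u).le (hr v).le]

theorem axisSquare_eq_preimage (p : EuclideanSpace ℝ (Fin 2)) {s : ℝ} (hs : 0 ≤ s) :
    axisSquare p s = WithLp.ofLp ⁻¹' Metric.closedBall (WithLp.ofLp p) (s / 2) := by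
  ext q
  simp [axisSquare, dist_pi_le_iff (div_nonneg hs zero_le_two), Real.dist_eq]

/-- Axis-aligned squares are the balls of the maximum norm, with side twice the radius. -/
theorem IsBallGraph.isSquareGraph {V : Type*} {G : SimpleGraph V}
    (h : G.IsBallGraph (Fin 2 → ℝ)) : G.IsSquareGraph := by
  obtain ⟨p, r, hr, h⟩ := h
  refine ⟨fun v => WithLp.toLp 2 (p v), fun v => 2 * r v, fun v => by simpa using hr v,
    fun u v => ?_⟩
  have hr' : ∀ v, 0 ≤ 2 * r v := fun v => by linarith [hr v]
  simp only [axisSquare_eq_preimage _ (hr' _)]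
  rw [h, ← closedBall_inter_closedBall_nonempty_iff (hr u).le (hr v).le, ← Set.preimage_inter,
    (WithLp.ofLp_surjective 2).nonempty_preimage]
  simp

theorem IsBallGraph.comap {E : Type*} [NormedAddCommGroup E] {V W : Type*} {G : SimpleGraph V}
    (h : G.IsBallGraph E) {f : W → V} (hf : f.Injective) : (G.comap f).IsBallGraph E := by
  obtain ⟨p, r, hr, h⟩ := h
  exact ⟨p ∘ f, r ∘ f, fun v => hr _, fun u v => by simp [h, hf.eq_iff]⟩

/-- Adding a far away ball. -/
theorem IsBallGraph.exists_isolated {E : Type*} [NormedAddCommGroup E] [NormedSpace ℝ E]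
    [Nontrivial E] {n : ℕ} {G : SimpleGraph (Fin n)} (h : G.IsBallGraph E) :
    ∃ H : SimpleGraph (Fin (n + 1)), H.IsBallGraph E ∧ H.comap Fin.castSucc = G ∧
      ∀ i, ¬ H.Adj i (Fin.last n) := by
  obtain ⟨p, r, hr, h⟩ := h
  obtain ⟨M, hM⟩ := (Set.finite_range fun v => ‖p v‖ + r v + 1).bddAbove
  obtain ⟨z, hz⟩ := NormedSpace.exists_lt_norm ℝ E M
  let p' : Fin (n + 1) → E := Fin.lastCases z p
  let r' : Fin (n + 1) → ℝ := Fin.lastCases 1 r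
  have hr' : ∀ v, 0 < r' v := Fin.lastCases (by simp [r']) (by simpa [r'] using hr)
  let H : SimpleGraph (Fin (n + 1)) :=
    { Adj := fun u v => u ≠ v ∧ Dist.dist (p' u) (p' v) ≤ r' u + r' v
      symm := ⟨fun u v h => ⟨h.1.symm, by rw [_root_.dist_comm, add_comm]; exact h.2⟩⟩
      loopless := ⟨fun u h => h.1 rfl⟩ }
  refine ⟨H, ⟨p', r', hr', fun _ _ => Iff.rfl⟩, ?_, fun i => ?_⟩
  · ext u v
    simp [H, p', r', h]
  · induction i using Fin.lastCases with
    | last => exact H.loopless.irrefl _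
    | cast v =>
      rintro ⟨-, hv⟩
      have h1 : ‖p v‖ + r v + 1 ≤ M := hM ⟨v, rfl⟩
      simp only [p', r', Fin.lastCases_castSucc, Fin.lastCases_last] at hv
      have h2 := norm_sub_norm_le z (p v)
      rw [← dist_eq_norm, _root_.dist_comm] at h2
      linarith

/-- If the points `q t` lie in the interior of exactly the balls with indices in `S t`, then small
copies of `G` can be placed at these points. -/
theorem IsBallGraph.exists_isAttachment {E : Type*} [NormedAddCommGroup E] [NormedSpace ℝ E]
    {ι T V : Type*} [Finite ι] [Finite T] [Finite V] {G : SimpleGraph V} (hG : G.IsBallGraph E)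
    {S : T → Set ι} {c : ι → E} {R : ℝ} (hR : 0 < R) {q : T → E} (hq : q.Injective)
    (hin : ∀ t, ∀ i ∈ S t, Dist.dist (c i) (q t) < R) (hout : ∀ t, ∀ i ∉ S t, R < Dist.dist (c i) (q t)) :
    ∃ K : SimpleGraph (ι ⊕ T × V), K.IsBallGraph E ∧ G.IsAttachment S K := by
  obtain ⟨p, r, hr, hG⟩ := hG
  -- Each requirement is a strict inequality at `ε = 0`, so by continuity and finiteness all hold
  -- for small `ε > 0`.
  have e1 : ∀ᶠ ε : ℝ in 𝓝[>] 0, ∀ t v, ∀ i ∈ S t, Dist.dist (c i) (q t + ε • p v) < R + ε * r v := by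
    simp only [eventually_all]
    refine fun t v i hi => ((Continuous.tendsto' (by fun_prop) 0 _ rfl).eventually_lt
      (Continuous.tendsto' (by fun_prop) 0 _ rfl) ?_).filter_mono nhdsWithin_le_nhds
    simpa using hin t i hi
  have e2 : ∀ᶠ ε : ℝ in 𝓝[>] 0, ∀ t v, ∀ i ∉ S t, R + ε * r v < Dist.dist (c i) (q t + ε • p v) := by
    simp only [eventually_all]
    refine fun t v i hi => ((Continuous.tendsto' (by fun_prop) 0 _ rfl).eventually_lt
      (Continuous.tendsto' (by fun_prop) 0 _ rfl) ?_).filter_mono nhdsWithin_le_nhds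
    simpa using hout t i hi
  have e3 : ∀ᶠ ε : ℝ in 𝓝[>] 0, ∀ t v t' v', t ≠ t' →
      ε * r v + ε * r v' < Dist.dist (q t + ε • p v) (q t' + ε • p v') := by
    simp only [eventually_all]
    refine fun t v t' v' ht => ((Continuous.tendsto' (by fun_prop) 0 _ rfl).eventually_lt
      (Continuous.tendsto' (by fun_prop) 0 _ rfl) ?_).filter_mono nhdsWithin_le_nhds
    simpa using hq.ne ht
  obtain ⟨ε, e1, e2, e3, hε⟩ :=
    (e1.and (e2.and (e3.and (self_mem_nhdsWithin : Set.Ioi (0 : ℝ) ∈ 𝓝[>] 0)))).exists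
  have hε : 0 < ε := hε
  let P : ι ⊕ T × V → E := Sum.elim c fun x => q x.1 + ε • p x.2
  let Q : ι ⊕ T × V → ℝ := Sum.elim (fun _ => R) fun x => ε * r x.2
  let K : SimpleGraph (ι ⊕ T × V) :=
    { Adj := fun u v => u ≠ v ∧ Dist.dist (P u) (P v) ≤ Q u + Q v
      symm := ⟨fun u v h => ⟨h.1.symm, by rw [_root_.dist_comm, add_comm]; exact h.2⟩⟩
      loopless := ⟨fun u h => h.1 rfl⟩ }
  refine ⟨K, ⟨P, Q, ?_, fun _ _ => Iff.rfl⟩, ⟨fun t v t' v' => ?_, fun i t v => ?_⟩⟩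
  · rintro (i | ⟨t, v⟩)
    · exact hR
    · exact mul_pos hε (hr v)
  · change _ ∧ Dist.dist (q t + ε • p v) (q t' + ε • p v') ≤ ε * r v + ε * r v' ↔ _
    by_cases ht : t = t'
    · subst ht
      rw [dist_add_left, dist_smul₀, Real.norm_of_nonneg hε.le, ← mul_add,
        mul_le_mul_iff_right₀ hε, hG]
      simp
    · simp [ht, (e3 t v t' v' ht).not_ge]
  · change _ ∧ Dist.dist (c i) (q t + ε • p v) ≤ R + ε * r v ↔ _
    by_cases hi : i ∈ S t
    · simp [hi, (e1 t v i hi).le]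
    · simp [hi, (e2 t v i hi).not_ge]

/-- For every `l` there are `l` congruent balls in `E` such that each interval of them is the set
of balls containing some point (in the interior), in two ways. -/
def _root_.HasIntervalCells (E : Type*) [NormedAddCommGroup E] : Prop :=
  ∀ l : ℕ, ∃ (c : Fin l → E) (R : ℝ) (q : DoubledInterval l → E), 0 < R ∧ q.Injective ∧
    (∀ t, ∀ i ∈ t.toSet, Dist.dist (c i) (q t) < R) ∧ ∀ t, ∀ i ∉ t.toSet, R < Dist.dist (c i) (q t)

theorem exists_isBallGraph_not_conflictFreeColorable {E : Type*} [NormedAddCommGroup E]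
    [NormedSpace ℝ E] (hE : HasIntervalCells E) (m : ℕ) :
    ∃ n, 1 ≤ n ∧ n ≤ 2 ^ (m ^ 2 + 3 * m) ∧
      ∃ G : SimpleGraph (Fin n), G.IsBallGraph E ∧ ¬ G.ConflictFreeColorable m := by
  induction m with
  | zero =>
    refine ⟨1, le_rfl, le_rfl, ⊥, ⟨fun _ => 0, fun _ => 1, fun _ => one_pos, fun u v => ?_⟩, ?_⟩
    · simp [Subsingleton.elim u v]
    · rintro ⟨χ, hχ⟩
      obtain ⟨-, -, a, -⟩ := hχ 0
      exact a.elim0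
  | succ m ih =>
    obtain ⟨n, hn, hnm, G, hG, hGm⟩ := ih
    obtain ⟨c, R, q, hR, hq, hin, hout⟩ := hE (2 ^ (m + 1))
    obtain ⟨K, hK, hKG⟩ := hG.exists_isAttachment hR hq hin hout
    let e := (Fintype.equivFin (Fin (2 ^ (m + 1)) ⊕ DoubledInterval (2 ^ (m + 1)) × Fin n)).symm
    have hl : 1 ≤ 2 ^ (m + 1) := Nat.one_le_two_pow
    have hcard : Fintype.card {p : Fin (2 ^ (m + 1)) × Fin (2 ^ (m + 1)) // p.1 ≤ p.2} ≤
        2 ^ (m + 1) * 2 ^ (m + 1) := by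
      simpa using Fintype.card_subtype_le
        (fun p : Fin (2 ^ (m + 1)) × Fin (2 ^ (m + 1)) => p.1 ≤ p.2)
    refine ⟨_, ?_, ?_, K.comap e, hK.comap e.injective,
      fun h => hKG.not_conflictFreeColorable hGm (h.of_comap_equiv e)⟩
    · simp only [Fintype.card_sum, Fintype.card_fin]
      omega
    · simp only [Fintype.card_sum, Fintype.card_fin, Fintype.card_prod, Fintype.card_bool]
      -- The exponent `m ^ 2 + 3 * m` grows by `2 * m + 4`, which accounts for the factor `4 * l ^
      -- 2` with `l = 2 ^ (m + 1)`.
      have hpow : 2 ^ ((m + 1) ^ 2 + 3 * (m + 1)) =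
          4 * (2 ^ (m + 1) * 2 ^ (m + 1)) * 2 ^ (m ^ 2 + 3 * m) := by
        rw [← pow_add, show 4 = 2 ^ 2 from rfl, ← pow_add, ← pow_add]
        congr 1
        ring
      rw [hpow]
      generalize 2 ^ (m + 1) = l at *
      have h1 : l ≤ l * l * n := by nlinarith [Nat.mul_le_mul hl hn]
      calc _ ≤ l * l * n + l * l * 2 * n := by gcongr
        _ ≤ 4 * (l * l) * n := by nlinarith
        _ ≤ _ := by gcongr

theorem exists_isBallGraph_of_le {E : Type*} [NormedAddCommGroup E] [NormedSpace ℝ E]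
    [Nontrivial E] {n N k : ℕ} (hN : n ≤ N) {G : SimpleGraph (Fin n)} (hG : G.IsBallGraph E)
    (hk : ¬ G.ConflictFreeColorable k) :
    ∃ H : SimpleGraph (Fin N), H.IsBallGraph E ∧ ¬ H.ConflictFreeColorable k := by
  induction N, hN using Nat.le_induction with
  | base => exact ⟨G, hG, hk⟩
  | succ N _ ih =>
    obtain ⟨H, hH, hHk⟩ := ih
    obtain ⟨H', hH', rfl, hiso⟩ := hH.exists_isolated
    exact ⟨H', hH', fun h => hHk (h.comap_castSucc_of_isolated hiso)⟩

/-! ### The two bounds for ball graphs -/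

theorem exists_isBallGraph_sqrt_log_le {E : Type*} [NormedAddCommGroup E] [NormedSpace ℝ E]
    [Nontrivial E] (hE : HasIntervalCells E) {n : ℕ} (hn : 1 ≤ n) :
    ∃ G : SimpleGraph (Fin n), G.IsBallGraph E ∧
      1 / 2 * Real.sqrt (Real.log (n : ℝ)) ≤ (G.conflictFreeNumber : ℝ) := by
  -- The least such index is `m + 1`: its predecessor `m` gives a graph small enough to pad to `n`
  -- vertices, while `n < 2 ^ ((m + 1) ^ 2 + 3 * (m + 1))` bounds `log n` by `4 * (m + 1) ^ 2`.
  have hex : ∃ m, n < 2 ^ (m ^ 2 + 3 * m) :=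
    ⟨n, Nat.lt_two_pow_self.trans_le (Nat.pow_le_pow_right two_pos (by nlinarith))⟩
  obtain ⟨m, hm⟩ : ∃ m, Nat.find hex = m + 1 := Nat.exists_eq_succ_of_ne_zero fun h => by
    have := Nat.find_spec hex
    rw [h] at this
    simp at this
    omega
  have hlt := Nat.find_spec hex
  have hle := Nat.find_min hex (m := m) (by omega)
  rw [hm] at hlt
  obtain ⟨n', -, hn', G, hG, hGm⟩ := exists_isBallGraph_not_conflictFreeColorable hE m
  obtain ⟨H, hH, hHm⟩ := exists_isBallGraph_of_le (hn'.trans (not_lt.1 hle)) hG hGm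
  refine ⟨H, hH, ?_⟩
  have h1 : m + 1 ≤ H.conflictFreeNumber := by
    by_contra! h
    exact hHm (conflictFreeNumber_le_iff.1 (Nat.lt_succ_iff.1 h))
  have h2 : Real.sqrt (Real.log n) ≤ 2 * (m + 1) := by
    refine Real.sqrt_le_iff.2 ⟨by positivity, ?_⟩
    have hlog : Real.log n ≤ ((m + 1) ^ 2 + 3 * (m + 1) : ℕ) * Real.log 2 := by
      rw [← Real.log_pow]
      exact Real.log_le_log (by exact_mod_cast hn) (by exact_mod_cast hlt.le)
    have hlog2 : Real.log 2 ≤ 1 := by linarith [Real.log_two_lt_d9]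
    refine (hlog.trans (mul_le_of_le_one_right (by positivity) hlog2)).trans ?_
    push_cast
    nlinarith [(Nat.cast_nonneg m : (0 : ℝ) ≤ m)]
  have h3 : ((m + 1 : ℕ) : ℝ) ≤ H.conflictFreeNumber := by exact_mod_cast h1
  push_cast at h3
  linarith

theorem exists_isBallGraph_conflictFreeNumber_eq {E : Type*} [NormedAddCommGroup E]
    [NormedSpace ℝ E] (hE : HasIntervalCells E) {k : ℕ} (hk : 1 ≤ k) :
    ∃ (n : ℕ) (G : SimpleGraph (Fin n)), G.IsBallGraph E ∧ G.conflictFreeNumber = k ∧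
      (n : ℝ) ≤ 1 * 2 ^ (2 * k ^ 2) := by
  obtain ⟨m, rfl⟩ := Nat.exists_eq_add_of_le' hk
  obtain ⟨n, -, hn, G, hG, hGm⟩ := exists_isBallGraph_not_conflictFreeColorable hE m
  obtain ⟨n', hn', H, hH, hHk⟩ := exists_conflictFreeNumber_eq (k := m + 1)
    (P := fun _ G => G.IsBallGraph E) (fun n G hG => hG.comap (Fin.castSucc_injective n)) G hG (by
      by_contra! h
      exact hGm (conflictFreeNumber_le_iff.1 (Nat.lt_succ_iff.1 h)))
  refine ⟨n', H, hH, hHk, ?_⟩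
  have : n' ≤ 2 ^ (2 * (m + 1) ^ 2) :=
    (hn'.trans hn).trans (Nat.pow_le_pow_right two_pos (by nlinarith))
  rw [one_mul]
  exact_mod_cast this

end SimpleGraph

/-! ### Interval cells in the Euclidean and in the maximum norm -/

/-- Two offsets less than one, by which the two copies of an interval are distinguished. -/
noncomputable def intervalOffset (β : Bool) : ℝ := if β then 1 / 2 else 1 / 4

theorem intervalOffset_pos (β : Bool) : 0 < intervalOffset β := by
  cases β <;> norm_num [intervalOffset]

theorem intervalOffset_lt_one (β : Bool) : intervalOffset β < 1 := by
  cases β <;> norm_num [intervalOffset]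

/-- The offsets differ modulo 1, so the left endpoint alone recovers the offset. This makes the
chosen points distinct. -/
theorem DoubledInterval.ext_of_endpoints {l : ℕ} {t t' : DoubledInterval l}
    (h1 : ((t.1.1.1 : ℕ) : ℝ) - intervalOffset t.2 = (t'.1.1.1 : ℕ) - intervalOffset t'.2)
    (h2 : ((t.1.1.2 : ℕ) : ℝ) + intervalOffset t.2 = (t'.1.1.2 : ℕ) + intervalOffset t'.2) :
    t = t' := by
  obtain ⟨⟨⟨⟨a, _⟩, ⟨b, _⟩⟩, _⟩, β⟩ := t
  obtain ⟨⟨⟨⟨a', _⟩, ⟨b', _⟩⟩, _⟩, β'⟩ := t'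
  dsimp only at h1 h2
  have ha : (4 * a + (if β' then 2 else 1) : ℕ) = 4 * a' + (if β then 2 else 1) := by
    rify
    cases β <;> cases β' <;> simp [intervalOffset] at h1 ⊢ <;> linarith
  have hb : (4 * b + (if β then 2 else 1) : ℕ) = 4 * b' + (if β' then 2 else 1) := by
    rify
    cases β <;> cases β' <;> simp [intervalOffset] at h2 ⊢ <;> linarith
  obtain ⟨rfl, rfl, rfl⟩ : a = a' ∧ b = b' ∧ β = β' := by
    cases β <;> cases β' <;> simp at ha hb ⊢ <;> omega
  rfl

/-- The real bounds that membership and nonmembership in an interval amount to. -/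
theorem DoubledInterval.bounds {l : ℕ} (t : DoubledInterval l) :
    (0 : ℝ) ≤ (t.1.1.1 : ℕ) ∧ ((t.1.1.1 : ℕ) : ℝ) ≤ (t.1.1.2 : ℕ) ∧
      ((t.1.1.2 : ℕ) : ℝ) + 1 ≤ l := by
  refine ⟨by positivity, by exact_mod_cast t.1.2, by exact_mod_cast t.1.1.2.2⟩

theorem DoubledInterval.bounds_of_mem {l : ℕ} {t : DoubledInterval l} {i : Fin l}
    (h : i ∈ t.toSet) :
    ((t.1.1.1 : ℕ) : ℝ) ≤ (i : ℕ) ∧ ((i : ℕ) : ℝ) ≤ (t.1.1.2 : ℕ) :=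
  ⟨by exact_mod_cast h.1, by exact_mod_cast h.2⟩

theorem DoubledInterval.bounds_of_notMem {l : ℕ} {t : DoubledInterval l} {i : Fin l}
    (h : i ∉ t.toSet) :
    ((i : ℕ) : ℝ) + 1 ≤ (t.1.1.1 : ℕ) ∨ ((t.1.1.2 : ℕ) : ℝ) + 1 ≤ (i : ℕ) := by
  simp only [DoubledInterval.toSet, Set.mem_Icc, not_and_or, not_le] at h
  exact h.imp (fun h => by exact_mod_cast h) fun h => by exact_mod_cast h

/-- Squares along the diagonal. -/
theorem hasIntervalCells_pi : HasIntervalCells (Fin 2 → ℝ) := by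
  intro l
  -- With interval `[a, b]` and offset `o`, the first coordinate tests `a - o < i` and the second `i
  -- < b + o`. The radius `l + 1` is large enough that the opposite sides never matter.
  refine ⟨fun i => ![(i : ℕ), -((i : ℕ) : ℝ)], l + 1,
    fun t => ![(t.1.1.1 : ℕ) - intervalOffset t.2 + (l + 1),
      (l + 1) - ((t.1.1.2 : ℕ) + intervalOffset t.2)], by positivity, ?_, ?_, ?_⟩
  · intro t t' h
    have h0 := congrFun h 0
    have h1 := congrFun h 1
    simp only [Matrix.cons_val_zero, Matrix.cons_val_one] at h0 h1
    exact DoubledInterval.ext_of_endpoints (by linarith) (by linarith)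
  · intro t i hi
    have := t.bounds
    have := DoubledInterval.bounds_of_mem hi
    have := intervalOffset_pos t.2
    have := intervalOffset_lt_one t.2
    rw [dist_pi_lt_iff (by positivity), Fin.forall_fin_two]
    simp only [Matrix.cons_val_zero, Matrix.cons_val_one, Real.dist_eq, abs_lt]
    refine ⟨⟨?_, ?_⟩, ?_, ?_⟩ <;> linarith
  · intro t i hi
    have := intervalOffset_lt_one t.2
    rcases DoubledInterval.bounds_of_notMem hi with h | h
    · refine lt_of_lt_of_le ?_ (dist_le_pi_dist _ _ 0)
      simp only [Matrix.cons_val_zero, Real.dist_eq, lt_abs]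
      right
      linarith
    · refine lt_of_lt_of_le ?_ (dist_le_pi_dist _ _ 1)
      simp only [Matrix.cons_val_one, Matrix.cons_val_fin_one, Real.dist_eq, lt_abs]
      right
      linarith

/-- Disks along a line. -/
theorem hasIntervalCells_euclidean : HasIntervalCells (EuclideanSpace ℝ (Fin 2)) := by
  intro l
  -- The height `√((l + 1) ^ 2 - w ^ 2)` makes the point lie inside the disk at `i` exactly when `|i
  -- - x| < w`; here `x - w` and `x + w` are the endpoints of the interval, moved outward by the
  -- offset.
  let x : DoubledInterval l → ℝ := fun t => ((t.1.1.1 : ℕ) + (t.1.1.2 : ℕ)) / 2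
  let w : DoubledInterval l → ℝ := fun t =>
    (((t.1.1.2 : ℕ) : ℝ) - (t.1.1.1 : ℕ)) / 2 + intervalOffset t.2
  have hw : ∀ t, 0 < w t ∧ w t ≤ l + 1 := fun t => by
    have := t.bounds
    have := intervalOffset_pos t.2
    have := intervalOffset_lt_one t.2
    constructor <;> simp only [w] <;> linarith
  have hsq : ∀ t, 0 ≤ ((l : ℝ) + 1) ^ 2 - w t ^ 2 := fun t => by nlinarith [hw t]
  have hdist : ∀ (i : Fin l) t, dist (!₂[((i : ℕ) : ℝ), 0] : EuclideanSpace ℝ (Fin 2))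
      !₂[x t, Real.sqrt ((l + 1) ^ 2 - w t ^ 2)] =
      Real.sqrt (((i : ℕ) - x t) ^ 2 + ((l + 1) ^ 2 - w t ^ 2)) := fun i t => by
    rw [EuclideanSpace.dist_eq]
    simp [Fin.sum_univ_two, Real.dist_eq, sq_abs, Real.sq_sqrt (hsq t)]
  refine ⟨fun i => !₂[(i : ℕ), 0], l + 1,
    fun t => !₂[x t, Real.sqrt ((l + 1) ^ 2 - w t ^ 2)], by positivity, ?_, ?_, ?_⟩
  · intro t t' h
    have h0 : x t = x t' := by simpa using congrArg (fun z : EuclideanSpace ℝ (Fin 2) => z 0) h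
    have h1 : Real.sqrt ((l + 1) ^ 2 - w t ^ 2) = Real.sqrt ((l + 1) ^ 2 - w t' ^ 2) := by
      simpa using congrArg (fun z : EuclideanSpace ℝ (Fin 2) => z 1) h
    rw [Real.sqrt_inj (hsq t) (hsq t'), sub_right_inj,
      sq_eq_sq₀ (hw t).1.le (hw t').1.le] at h1
    simp only [x, w] at h0 h1
    exact DoubledInterval.ext_of_endpoints (by linarith) (by linarith)
  · intro t i hi
    have := DoubledInterval.bounds_of_mem hi
    have := intervalOffset_pos t.2
    rw [hdist, Real.sqrt_lt' (by positivity)]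
    have : ((i : ℕ) - x t) ^ 2 < w t ^ 2 := by
      apply sq_lt_sq' <;> simp only [x, w] <;> linarith
    linarith
  · intro t i hi
    have := intervalOffset_lt_one t.2
    rw [hdist, Real.lt_sqrt (by positivity)]
    have : w t ^ 2 < ((i : ℕ) - x t) ^ 2 := by
      rw [sq_lt_sq, abs_of_pos (hw t).1, lt_abs]
      simp only [x, w]
      rcases DoubledInterval.bounds_of_notMem hi with h | h
      · right; linarith
      · left; linarith
    linarith

theorem mainTheorem4 :
    ((∃ c : ℝ, 0 < c ∧ ∀ n : ℕ, 1 ≤ n → ∃ G : SimpleGraph (Fin n), G.IsDiskGraph ∧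
        c * Real.sqrt (Real.log (n : ℝ)) ≤ (G.conflictFreeNumber : ℝ)) ∧
      (∃ C : ℝ, 0 < C ∧ ∀ k : ℕ, 1 ≤ k → ∃ (n : ℕ) (G : SimpleGraph (Fin n)), G.IsDiskGraph ∧
        G.conflictFreeNumber = k ∧ (n : ℝ) ≤ C * 2 ^ (2 * k ^ 2))) ∧
    ((∃ c : ℝ, 0 < c ∧ ∀ n : ℕ, 1 ≤ n → ∃ G : SimpleGraph (Fin n), G.IsSquareGraph ∧
        c * Real.sqrt (Real.log (n : ℝ)) ≤ (G.conflictFreeNumber : ℝ)) ∧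
      (∃ C : ℝ, 0 < C ∧ ∀ k : ℕ, 1 ≤ k → ∃ (n : ℕ) (G : SimpleGraph (Fin n)), G.IsSquareGraph ∧
        G.conflictFreeNumber = k ∧ (n : ℝ) ≤ C * 2 ^ (2 * k ^ 2))) := by
  refine ⟨⟨⟨1 / 2, by norm_num, fun n hn => ?_⟩, 1, one_pos, fun k hk => ?_⟩,
    ⟨1 / 2, by norm_num, fun n hn => ?_⟩, 1, one_pos, fun k hk => ?_⟩
  · obtain ⟨G, hG, h⟩ :=
      SimpleGraph.exists_isBallGraph_sqrt_log_le hasIntervalCells_euclidean hn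
    exact ⟨G, hG.isDiskGraph, h⟩
  · obtain ⟨n, G, hG, h⟩ :=
      SimpleGraph.exists_isBallGraph_conflictFreeNumber_eq hasIntervalCells_euclidean hk
    exact ⟨n, G, hG.isDiskGraph, h⟩
  · obtain ⟨G, hG, h⟩ := SimpleGraph.exists_isBallGraph_sqrt_log_le hasIntervalCells_pi hn
    exact ⟨G, hG.isSquareGraph, h⟩
  · obtain ⟨n, G, hG, h⟩ :=
      SimpleGraph.exists_isBallGraph_conflictFreeNumber_eq hasIntervalCells_pi hk
    exact ⟨n, G, hG.isSquareGraph, h⟩
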